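/- Let $L/K$ be an extension of number fields with $[L:K]=3$, and assume that $\mathcal{O}_L$ is a free $\mathcal{O}_K$-module. For an $\mathcal{O}_K$-basis $\mathcal{B}=\{1,\omega_2,\omega_3\}$ of $\mathcal{O}_L$, the index form $I_{\mathcal{B}}\in\mathcal{O}_K[X,Y]$ is the binary cubic form defined by $1\wedge\gamma\wedge\gamma^2=I_{\mathcal{B}}(X,Y)\,(1\wedge\omega_2\wedge\omega_3)$ with $\gamma=X\omega_2+Y\omega_3$. The field $L$ is called quasi-monogenic over $K$ if $I_{\mathcal{B}}(x,y)\in\mathcal{O}_K^\times$ for some $(x,y)\in K^2$ (this does not depend on the choice of $\mathcal{B}$). The discriminant of $L$ over $K$ is the class, modulo squares of units of $\mathcal{O}_K$, of $\operatorname{disc}(\mathcal{B})=\det(\operatorname{Tr}(\omega_i\omega_j))$ for any $\mathcal{O}_K$-basis $\mathcal{B}=\{\omega_1,\omega_2,\omega_3\}$ of $\mathcal{O}_L$. For $k\in K$ let $E^k$ be the curve $Y^2=4X^3+k$, and for $D\in K$ and an affine point $P=(x_0,y_0)\in E^{-27D}(K)$ let $L_P=K[X]/(X^3-x_0X^2+D)$.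 **Theorem.** (1) $L$ is quasi-monogenic over $K$ if and only if, for some representative $D$ of the discriminant of $L$ over $K$ and some affine point $P\in E^{-27D}(K)$, $L$ is isomorphic to $L_P$ as a $K$-algebra. (2) More precisely, let $\mathcal{B}=\{1,\omega_2,\omega_3\}$ be an $\mathcal{O}_K$-basis of $\mathcal{O}_L$ and let $D=\operatorname{disc}(\mathcal{B})$. Then $I_{\mathcal{B}}(x,y)=\pm1$ has a solution $(x,y)\in K^2$ if and only if $L$ is isomorphic to $L_P$ as a $K$-algebra for some affine point $P\in E^{-27D}(K)$. -/

import Mathlib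

open scoped NumberField TensorProduct

noncomputable section

/-- The generic element `γ = X₁ b₁ + ⋯ + Xₙ bₙ` of the base change `A[X₁, …, Xₙ] ⊗ B`, where
`b₀, b₁, …, bₙ` is an `A`-basis of `B` (to be used with `b₀ = 1`). -/
def genericElement {A B : Type*} [CommRing A] [CommRing B] [Algebra A B] {n : ℕ}
    (b : Module.Basis (Fin (n + 1)) A B) : MvPolynomial (Fin n) A ⊗[A] B :=
  ∑ i : Fin n, (MvPolynomial.X i : MvPolynomial (Fin n) A) ⊗ₜ[A] b i.succ

/-- The index form `I_b ∈ A[X₁, …, Xₙ]` of a free `A`-algebra `B` of rank `n + 1` with respect to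
an `A`-basis `b₀ = 1, b₁, …, bₙ`. It is characterized by
`1 ∧ γ ∧ γ² ∧ ⋯ ∧ γⁿ = I_b · (1 ∧ b₁ ∧ ⋯ ∧ bₙ)` for the generic element
`γ = X₁ b₁ + ⋯ + Xₙ bₙ`; that is, `I_b` is the determinant of the coordinates of
`1, γ, …, γⁿ` in the basis `b`. -/
def indexForm {A B : Type*} [CommRing A] [CommRing B] [Algebra A B] {n : ℕ}
    (b : Module.Basis (Fin (n + 1)) A B) : MvPolynomial (Fin n) A :=
  (Algebra.TensorProduct.basis (MvPolynomial (Fin n) A) b).det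
    (fun k : Fin (n + 1) => genericElement b ^ (k : ℕ))

/-- A free `A`-algebra `B` of rank `n + 1` is quasi-monogenic if its index form represents a unit
of `A` over the fraction field `K` of `A`: `I_b(x) ∈ Aˣ` for some `x ∈ Kⁿ`, where
`b = (1, b₁, …, bₙ)` is an `A`-basis of `B`. (Another basis of this form changes `I_b` by an
invertible linear substitution over `A` and a unit factor, so the choice of `b` is immaterial.) -/
def IsQuasiMonogenic (A B K : Type*) [CommRing A] [CommRing B] [Algebra A B] [Field K]
    [Algebra A K] (n : ℕ) : Prop :=
  ∃ b : Module.Basis (Fin (n + 1)) A B, b 0 = 1 ∧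
    ∃ (x : Fin n → K) (u : Aˣ),
      MvPolynomial.aeval x (indexForm b) = algebraMap A K (u : A)

/-- The number field extension `L / K` of degree 3 is quasi-monogenic: `𝓞 L` is quasi-monogenic
over `𝓞 K`. -/
def IsQuasiMonogenicCubic (K L : Type*) [Field K] [NumberField K] [Field L] [NumberField L]
    [Algebra K L] : Prop :=
  IsQuasiMonogenic (𝓞 K) (𝓞 L) K 2

/-- `D ∈ K` represents the relative discriminant of the cubic extension `L / K` with `𝓞 L` free
over `𝓞 K`, a class modulo squares of units of `𝓞 K`: `D = det (Tr (bᵢ bⱼ))` for some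
`𝓞 K`-basis `b` of `𝓞 L`. -/
def IsRelativeDiscriminant (K L : Type*) [Field K] [NumberField K] [Field L] [NumberField L]
    [Algebra K L] (D : K) : Prop :=
  ∃ b : Module.Basis (Fin 3) (𝓞 K) (𝓞 L), D = algebraMap (𝓞 K) K (Algebra.discr (𝓞 K) b)

/-- The affine `K`-rational points of the curve `E^k : Y² = 4 X³ + k`. -/
def affinePoints {K : Type*} [Field K] (k : K) : Set (K × K) :=
  {P | P.2 ^ 2 = 4 * P.1 ^ 3 + k}

/-- The `K`-algebra `L_P = K[X] / (X³ - x₀ X² + D)` attached to `P = (x₀, y₀)`. -/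
abbrev pointAlgebra {K : Type*} [Field K] (D : K) (P : K × K) : Type _ :=
  AdjoinRoot (Polynomial.X ^ 3 - Polynomial.C P.1 * Polynomial.X ^ 2 + Polynomial.C D :
    Polynomial K)

end

/-! By definition `I_B(x)` is the determinant of `1, γ, γ²` in the basis `B`, so `disc(1, γ, γ²) =
I_B(x)² disc(B)`. Representing a unit thus means that some `γ` in `L` has discriminant `D`, a
representative of the class. If `γ` has minimal polynomial `f` of discriminant `D`, the
characteristic polynomial of `f'(γ)` is `X³ - x₀X² + D`: its linear term vanishes. Depressing `f` to
`X³ + pX + q` and putting `x₀ = -3p`, `y₀ = 27q` (up to sign) turns `D = -4p³ - 27q²` into `y₀² =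
4x₀³ - 27D`. Conversely a point gives `p` and `q`, and `γ` is recovered from `θ = f'(γ)` by `γ(θ +
2p) = -3q`. -/

/-! ### Bases containing 1 over a Dedekind domain -/

section UnimodularRow

/-- A Dedekind domain has stable rank at most two. -/
theorem IsDedekindDomain.exists_isCoprime_add_mul {R : Type*} [CommRing R] [IsDedekindDomain R]
    {a b c : R} (h : Ideal.span {a, b, c} = ⊤) :
    ∃ s t : R, IsCoprime (a + s * c) (b + t * c) := by
  have hnot (M : Ideal R) (hM : M ≠ ⊤) (ha : a ∈ M) (hb : b ∈ M) (hc : c ∈ M) : False := by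
    refine hM (top_le_iff.mp (h ▸ Ideal.span_le.mpr ?_))
    rintro x (rfl | rfl | rfl) <;> assumption
  -- A nonzero `a + s * c` lies in only finitely many primes; otherwise `a = c = 0` and `b` is a
  -- unit.
  obtain ⟨s, hs⟩ | ⟨ha, hc⟩ : (∃ s : R, a + s * c ≠ 0) ∨ a = 0 ∧ c = 0 := by
    by_cases ha : a = 0
    · by_cases hc : c = 0
      · exact .inr ⟨ha, hc⟩
      · exact .inl ⟨1, by simpa [ha] using hc⟩
    · exact .inl ⟨0, by simpa using ha⟩
  · classical
    have hfin := Ideal.finite_factors (I := Ideal.span {a + s * c}) (by simpa using hs)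
    -- Chinese remainders: at each such prime `b + t * c` is congruent to `c` if `b` vanishes there
    -- and to `b` otherwise, hence is nonzero.
    obtain ⟨t, ht⟩ := IsDedekindDomain.exists_forall_sub_mem_ideal (s := hfin.toFinset)
      (fun v => v.asIdeal) (fun _ => 1) (fun v _ => v.prime)
      (fun v _ w _ hvw h => hvw (IsDedekindDomain.HeightOneSpectrum.ext h))
      (fun v => if b ∈ v.1.asIdeal then 1 else 0)
    refine ⟨s, t, ?_⟩
    rw [← Ideal.isCoprime_span_singleton_iff, Ideal.isCoprime_iff_sup_eq]
    by_contra hne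
    obtain ⟨M, hM, hle⟩ := Ideal.exists_le_maximal _ hne
    have h1 : a + s * c ∈ M := hle (Ideal.mem_sup_left (Ideal.mem_span_singleton_self _))
    have h2 : b + t * c ∈ M := hle (Ideal.mem_sup_right (Ideal.mem_span_singleton_self _))
    let v : IsDedekindDomain.HeightOneSpectrum R :=
      ⟨M, hM.isPrime, fun h0 => hs (by simpa [h0] using h1)⟩
    have hv : v ∈ hfin.toFinset := by
      simpa [Ideal.dvd_span_singleton] using h1
    have htv := ht v hv
    simp only [pow_one] at htv
    by_cases hb : b ∈ M
    · rw [if_pos hb] at htv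
      have hc : c ∈ M := by
        have := M.sub_mem (M.sub_mem h2 hb) (M.mul_mem_right c htv)
        ring_nf at this
        exact this
      exact hnot M hM.ne_top ((M.add_mem_iff_left (M.mul_mem_left s hc)).mp h1) hb hc
    · rw [if_neg hb, sub_zero] at htv
      exact hb ((M.add_mem_iff_left (M.mul_mem_right c htv)).mp h2)
  · refine ⟨0, 0, ?_⟩
    have hb : IsUnit b := by
      by_contra hb
      obtain ⟨M, hM, hbM⟩ := exists_max_ideal_of_mem_nonunits hb
      exact hnot M hM.ne_top (ha ▸ M.zero_mem) hbM (hc ▸ M.zero_mem)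
    obtain ⟨u, rfl⟩ := hb
    exact ⟨0, (u⁻¹ : Rˣ), by simp⟩

/-- If an integral extension of a Dedekind domain is free of rank three, then `1` is part of a
basis. -/
theorem Module.Basis.exists_zero_eq_one {R S : Type*} [CommRing R] [IsDedekindDomain R]
    [CommRing S] [Algebra R S] [FaithfulSMul R S] [Algebra.IsIntegral R S]
    (b : Module.Basis (Fin 3) R S) : ∃ b' : Module.Basis (Fin 3) R S, b' 0 = 1 := by
  have hone : b.repr 1 0 • b 0 + b.repr 1 1 • b 1 + b.repr 1 2 • b 2 = 1 := by
    rw [← Fin.sum_univ_three (fun i => b.repr 1 i • b i), b.sum_repr]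
  have htop : Ideal.span {b.repr 1 0, b.repr 1 1, b.repr 1 2} = ⊤ := by
    -- By integrality, it suffices that the coordinates of 1 generate the unit ideal of `S`.
    rw [← Ideal.map_eq_top_iff (algebraMap R S) (FaithfulSMul.algebraMap_injective R S)
      (algebraMap_isIntegral_iff.mpr inferInstance), Ideal.eq_top_iff_one]
    nth_rw 4 [← hone]
    simp only [Algebra.smul_def]
    refine add_mem (add_mem ?_ ?_) ?_ <;>
      exact Ideal.mul_mem_right _ _ (Ideal.mem_map_of_mem _ (Ideal.subset_span (by simp)))
  obtain ⟨s, t, p, q, hpq⟩ := IsDedekindDomain.exists_isCoprime_add_mul htop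
  -- The determinant expands to `p(a + sc) + q(b + tc) = 1`, where `a, b, c` are the coordinates of
  -- 1.
  have hdet : IsUnit (b.det ![1, -q • b 0 + p • b 1, -s • b 0 + -t • b 1 + b 2]) := by
    rw [Module.Basis.det_apply, Matrix.det_fin_three]
    convert! isUnit_one (M := R)
    simp [Module.Basis.toMatrix_apply]
    linear_combination hpq
  obtain ⟨hli, hsp⟩ := b.is_basis_iff_det.mpr hdet
  exact ⟨Module.Basis.mk hli hsp.ge, by simp⟩

end UnimodularRow

/-! ### Discriminants of power families -/

section Discriminant

theorem Algebra.discr_eq_det_sq_mul {A B ι : Type*} [CommRing A] [CommRing B] [Algebra A B]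
    [Fintype ι] [DecidableEq ι] (b : Module.Basis ι A B) (v : ι → B) :
    Algebra.discr A v = b.det v ^ 2 * Algebra.discr A b := by
  rw [Module.Basis.det_apply, ← Algebra.discr_of_matrix_vecMul, Module.Basis.toMatrix_map_vecMul]

/-- The discriminant of `1, γ, γ²` for a root `γ` of `X³ - aX² - bX - c`. -/
theorem Algebra.discr_pow_eq_of_cubic {A B : Type*} [CommRing A] [CommRing B] [Algebra A B]
    (e : Module.Basis (Fin 3) A B) {γ : B} (he : ∀ i, e i = γ ^ (i : ℕ)) {a b c : A}
    (h : γ ^ 3 = a • γ ^ 2 + b • γ + c • 1) :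
    Algebra.discr A (fun i : Fin 3 => γ ^ (i : ℕ)) =
      a ^ 2 * b ^ 2 + 4 * b ^ 3 - 4 * a ^ 3 * c - 27 * c ^ 2 - 18 * a * b * c := by
  have e0 : e 0 = 1 := by simpa using he 0
  have e1 : e 1 = γ := by simpa using he 1
  have e2 : e 2 = γ ^ 2 := by simpa using he 2
  have h' : γ ^ 3 = a • e 2 + b • e 1 + c • e 0 := by rw [h, e0, e1, e2]
  have h4 : γ ^ 4 = a • γ ^ 3 + b • γ ^ 2 + c • γ := by
    simp only [Algebra.smul_def] at h ⊢
    linear_combination γ * h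
  have h4' : γ ^ 4 = (a ^ 2 + b) • e 2 + (a * b + c) • e 1 + (a * c) • e 0 := by
    rw [h4, h, e0, e1, e2]
    simp only [Algebra.smul_def, map_add, map_mul, map_pow]
    ring
  have t0 : Algebra.trace A B 1 = 3 := by
    rw [Algebra.trace_eq_matrix_trace e, map_one, Matrix.trace_one]
    simp
  have t1 : Algebra.trace A B γ = a := by
    rw [Algebra.trace_eq_matrix_trace e, Matrix.trace, Fin.sum_univ_three]
    simp only [Matrix.diag_apply, Algebra.leftMulMatrix_eq_repr_mul]
    have m0 : γ * e 0 = e 1 := by rw [e0, e1, mul_one]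
    have m1 : γ * e 1 = e 2 := by rw [e1, e2]; ring
    have m2 : γ * e 2 = a • e 2 + b • e 1 + c • e 0 := by rw [← h', e2]; ring
    rw [m0, m1, m2]
    simp
  have t2 : Algebra.trace A B (γ ^ 2) = a ^ 2 + 2 * b := by
    rw [Algebra.trace_eq_matrix_trace e, Matrix.trace, Fin.sum_univ_three]
    simp only [Matrix.diag_apply, Algebra.leftMulMatrix_eq_repr_mul]
    have m0 : γ ^ 2 * e 0 = e 2 := by rw [e0, e2, mul_one]
    have m1 : γ ^ 2 * e 1 = a • e 2 + b • e 1 + c • e 0 := by rw [← h', e1]; ring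
    have m2 : γ ^ 2 * e 2 = (a ^ 2 + b) • e 2 + (a * b + c) • e 1 + (a * c) • e 0 := by
      rw [← h4', e2]; ring
    rw [m0, m1, m2]
    simp
    ring
  have t3 : Algebra.trace A B (γ ^ 3) = a * (a ^ 2 + 2 * b) + b * a + c * 3 := by
    rw [h]; simp only [map_add, map_smul, t0, t1, t2, smul_eq_mul]
  have t4 : Algebra.trace A B (γ ^ 4) =
      a * (a * (a ^ 2 + 2 * b) + b * a + c * 3) + b * (a ^ 2 + 2 * b) + c * a := by
    rw [h4]; simp only [map_add, map_smul, t1, t2, t3, smul_eq_mul]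
  have hm (i j : Fin 3) : Algebra.traceMatrix A (fun i : Fin 3 => γ ^ (i : ℕ)) i j =
      Algebra.trace A B (γ ^ ((i : ℕ) + j)) := by
    rw [Algebra.traceMatrix_apply, Algebra.traceForm_apply, pow_add]
  rw [Algebra.discr_def, Matrix.det_fin_three]
  simp only [hm]
  simp [t0, t1, t2, t3, t4]
  ring

end Discriminant

/-! ### Specialization of the index form -/

section IndexForm

/-- Specializing `X` to `x` carries the generic element to `∑ xᵢ eᵢ₊₁`, and determinants commute
with ring maps. -/
theorem aeval_indexForm {A B K L : Type*} [CommRing A] [CommRing B] [Algebra A B] [Field K]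
    [Algebra A K] [Field L] [Algebra K L] [Algebra A L] [Algebra B L] [IsScalarTower A K L]
    [IsScalarTower A B L] {n : ℕ} (b : Module.Basis (Fin (n + 1)) A B)
    (e : Module.Basis (Fin (n + 1)) K L) (he : ∀ i, e i = algebraMap B L (b i)) (x : Fin n → K) :
    MvPolynomial.aeval x (indexForm b) =
      e.det (fun k : Fin (n + 1) => (∑ i, x i • e i.succ) ^ (k : ℕ)) := by
  let φ : MvPolynomial (Fin n) A ⊗[A] B →ₐ[A] L :=
    Algebra.TensorProduct.lift ((IsScalarTower.toAlgHom A K L).comp (MvPolynomial.aeval x))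
      (IsScalarTower.toAlgHom A B L) (fun _ _ => Commute.all _ _)
  have hφ (z : MvPolynomial (Fin n) A ⊗[A] B) (i : Fin (n + 1)) :
      e.repr (φ z) i = MvPolynomial.aeval x
        ((Algebra.TensorProduct.basis (MvPolynomial (Fin n) A) b).repr z i) := by
    induction z with
    | zero => simp
    | add y z hy hz => simp [hy, hz]
    | tmul f β =>
      have hβ : algebraMap B L β = ∑ j, algebraMap A K (b.repr β j) • e j := by
        conv_lhs => rw [← b.sum_repr β]
        simp [he, Algebra.smul_def, ← IsScalarTower.algebraMap_apply]
      have : φ (f ⊗ₜ β) = MvPolynomial.aeval x f • algebraMap B L β := by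
        simp [φ, Algebra.smul_def]
      rw [this, hβ, map_smul, Finsupp.smul_apply, e.repr_sum_self, smul_eq_mul,
        Algebra.TensorProduct.basis_repr_tmul]
      simp
  have hgen : φ (genericElement b) = ∑ i, x i • e i.succ := by
    simp [φ, genericElement, he, Algebra.smul_def]
  rw [indexForm, Module.Basis.det_apply, Module.Basis.det_apply, ← hgen, ← AlgHom.coe_toRingHom,
    RingHom.map_det]
  congr 1
  ext i j
  simp [Module.Basis.toMatrix_apply, ← map_pow, hφ]

end IndexForm

/-! ### Elements of discriminant `D` and points of the curve -/

section CubicExtension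

theorem natDegree_minpoly_eq_three {K L : Type*} [Field K] [Field L] [Algebra K L]
    (hdeg : Module.finrank K L = 3) {θ : L} (hθ : θ ∉ (algebraMap K L).range) :
    (minpoly K θ).natDegree = 3 := by
  have : FiniteDimensional K L := .of_finrank_pos (by omega)
  have hdvd := minpoly.degree_dvd (IsIntegral.of_finite K θ)
  rw [hdeg, Nat.dvd_prime Nat.prime_three] at hdvd
  exact hdvd.resolve_left (mt minpoly.natDegree_eq_one_iff.mp hθ)

theorem exists_basis_pow {K L : Type*} [Field K] [Field L] [Algebra K L]
    (hdeg : Module.finrank K L = 3) {θ : L} (hθ : θ ∉ (algebraMap K L).range) :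
    ∃ e : Module.Basis (Fin 3) K L, ∀ i, e i = θ ^ (i : ℕ) := by
  have hli := linearIndependent_pow (K := K) θ
  rw [natDegree_minpoly_eq_three hdeg hθ] at hli
  exact ⟨basisOfLinearIndependentOfCardEqFinrank hli (by simp [hdeg]), fun i => by simp⟩

open Polynomial in
/-- An element outside `K` of a cubic extension which is a root of a monic cubic polynomial
identifies the extension with the corresponding quotient of `K[X]`. -/
theorem nonempty_algEquiv_adjoinRoot_of_cubic {K L : Type*} [Field K] [Field L] [Algebra K L]
    (hdeg : Module.finrank K L = 3) {θ : L} (hθ : θ ∉ (algebraMap K L).range) {f : K[X]}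
    (hf : f.Monic) (hf3 : f.natDegree = 3) (hroot : aeval θ f = 0) :
    Nonempty (L ≃ₐ[K] AdjoinRoot f) := by
  have : FiniteDimensional K L := .of_finrank_pos (by omega)
  have hint : IsIntegral K θ := .of_finite K θ
  have hmin := natDegree_minpoly_eq_three hdeg hθ
  have hfm : f = minpoly K θ :=
    (eq_of_monic_of_dvd_of_natDegree_le (minpoly.monic hint) hf (minpoly.dvd K θ hroot)
      (by omega))
  have : Fact (Irreducible f) := ⟨hfm ▸ minpoly.irreducible hint⟩
  have hfin : Module.finrank K (AdjoinRoot f) = 3 := by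
    rw [(AdjoinRoot.powerBasis hf.ne_zero).finrank, AdjoinRoot.powerBasis_dim, hf3]
  have : FiniteDimensional K (AdjoinRoot f) := .of_finrank_pos (by omega)
  let ψ : AdjoinRoot f →ₐ[K] L := AdjoinRoot.liftAlgHom f (Algebra.ofId K L) θ hroot
  have hinj : Function.Injective ψ := ψ.toRingHom.injective
  have hsurj : Function.Surjective ψ :=
    (LinearMap.injective_iff_surjective_of_finrank_eq_finrank (f := ψ.toLinearMap)
      (by omega)).mp hinj
  exact ⟨(AlgEquiv.ofBijective ψ ⟨hinj, hsurj⟩).symm⟩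

/-- If `γ` generates a cubic extension and has discriminant `D`, its different `f'(γ)` is a root of
`X³ - x₀ X² + D` for a point `(x₀, y₀)` of `E^{-27D}`. -/
theorem exists_algEquiv_pointAlgebra_of_discr {K L : Type*} [Field K] [CharZero K] [Field L]
    [Algebra K L] (hdeg : Module.finrank K L = 3) {γ : L} {D : K} (hD : D ≠ 0)
    (hγ : Algebra.discr K (fun i : Fin 3 => γ ^ (i : ℕ)) = D) :
    ∃ P ∈ affinePoints (-27 * D), Nonempty (L ≃ₐ[K] pointAlgebra D P) := by
  have hγK : γ ∉ (algebraMap K L).range := by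
    rintro ⟨k, rfl⟩
    refine hD (hγ ▸ Algebra.discr_zero_of_not_linearIndependent K fun hli => ?_)
    have := Fintype.linearIndependent_iff.mp hli ![-k, 1, 0]
      (by simp [Fin.sum_univ_three, Algebra.smul_def]) 1
    simp at this
  obtain ⟨e, he⟩ := exists_basis_pow hdeg hγK
  have e0 : e 0 = 1 := by simpa using he 0
  have e1 : e 1 = γ := by simpa using he 1
  have e2 : e 2 = γ ^ 2 := by simpa using he 2
  obtain ⟨a, b, c, h⟩ : ∃ a b c : K, γ ^ 3 = a • γ ^ 2 + b • γ + c • 1 :=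
    ⟨e.repr (γ ^ 3) 2, e.repr (γ ^ 3) 1, e.repr (γ ^ 3) 0, by
      conv_lhs => rw [← e.sum_repr (γ ^ 3), Fin.sum_univ_three, e0, e1, e2]
      ring⟩
  rw [Algebra.discr_pow_eq_of_cubic e he h] at hγ
  -- This is `f'(γ)`; its `γ²`-coordinate is `3 ≠ 0`.
  have hθ : (3 : K) • γ ^ 2 - (2 * a) • γ - b • 1 ∉ (algebraMap K L).range := by
    rintro ⟨k, hk⟩
    rw [Algebra.algebraMap_eq_smul_one, ← e0, ← e2, ← e1] at hk
    have := congrArg (fun z => e.repr z 2) hk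
    simp at this
  -- The trace of `f'(γ)`, and `-27 f(a/3)`.
  refine ⟨(a ^ 2 + 3 * b, 2 * a ^ 3 + 9 * a * b + 27 * c), ?_, ?_⟩
  · simp only [affinePoints, Set.mem_ofPred_eq, ← hγ]
    ring
  · refine nonempty_algEquiv_adjoinRoot_of_cubic hdeg hθ (by monicity!) (by compute_degree!) ?_
    simp only [← hγ, Algebra.smul_def, map_add, map_sub, map_mul, map_pow, Polynomial.aeval_X,
      Polynomial.aeval_C, map_ofNat] at h ⊢
    -- The multiplier is the quotient of `X³ - x₀X² + D`, evaluated at `f'`, by `f`.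
    linear_combination (27 * γ ^ 3 - 27 * algebraMap K L a * γ ^ 2 - 27 * algebraMap K L b * γ +
      (4 * algebraMap K L a ^ 3 + 18 * algebraMap K L a * algebraMap K L b +
        27 * algebraMap K L c)) * h

/-- If a cubic extension is the one attached to a point of `E^{-27D}`, it has an element of
discriminant `D`. -/
theorem exists_discr_pow_eq_of_algEquiv_pointAlgebra {K L : Type*} [Field K] [CharZero K] [Field L]
    [Algebra K L] (hdeg : Module.finrank K L = 3) {D : K} {P : K × K}
    (hP : P ∈ affinePoints (-27 * D)) (e : L ≃ₐ[K] pointAlgebra D P) :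
    ∃ γ : L, ∀ k : K, Algebra.discr K (fun i : Fin 3 => (γ - algebraMap K L k) ^ (i : ℕ)) = D := by
  obtain ⟨x₀, y₀⟩ := P
  have hP : y₀ ^ 2 = 4 * x₀ ^ 3 + -27 * D := hP
  obtain ⟨p, rfl⟩ : ∃ p, x₀ = -3 * p := ⟨-x₀ / 3, by ring⟩
  obtain ⟨q, rfl⟩ : ∃ q, y₀ = 27 * q := ⟨y₀ / 27, by ring⟩
  have hD : D = -4 * p ^ 3 - 27 * q ^ 2 := by linear_combination hP / 27
  obtain ⟨θ, hθK, hθ⟩ : ∃ θ : L, (∀ k : K, θ ≠ algebraMap K L k) ∧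
      θ ^ 3 + 3 * algebraMap K L p * θ ^ 2 + algebraMap K L D = 0 := by
    refine ⟨e.symm (AdjoinRoot.root _), fun k hk => ?_, ?_⟩
    · rw [← e.symm.commutes k, e.symm.injective.eq_iff] at hk
      have h0 : AdjoinRoot.mk (Polynomial.X ^ 3 - Polynomial.C (-3 * p) * Polynomial.X ^ 2 +
          Polynomial.C D : Polynomial K) (Polynomial.X - Polynomial.C k) = 0 := by
        rw [map_sub, AdjoinRoot.mk_X, AdjoinRoot.mk_C, sub_eq_zero]
        exact hk
      rw [AdjoinRoot.mk_eq_zero] at h0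
      have := Polynomial.natDegree_le_of_dvd h0 (Polynomial.X_sub_C_ne_zero k)
      rw [Polynomial.natDegree_X_sub_C] at this
      have h3 : (Polynomial.X ^ 3 - Polynomial.C (-3 * p) * Polynomial.X ^ 2 +
          Polynomial.C D : Polynomial K).natDegree = 3 := by compute_degree!
      omega
    · have := congrArg e.symm (AdjoinRoot.eval₂_root (Polynomial.X ^ 3 -
        Polynomial.C (-3 * p) * Polynomial.X ^ 2 + Polynomial.C D : Polynomial K))
      rw [← AdjoinRoot.algebraMap_eq, ← Polynomial.aeval_def] at this
      simp only [map_add, map_sub, map_mul, map_neg, map_pow, Polynomial.aeval_X,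
        Polynomial.aeval_C, map_zero, AlgEquiv.commutes, map_ofNat] at this
      linear_combination this
  have hθ' : (θ + 2 * algebraMap K L p) ^ 3 - 3 * algebraMap K L p * (θ + 2 * algebraMap K L p) ^ 2
      - 27 * algebraMap K L q ^ 2 = 0 := by
    have := congrArg (algebraMap K L) hD
    simp only [map_sub, map_mul, map_neg, map_pow, map_ofNat] at this
    linear_combination hθ - this
  have ht : θ + 2 * algebraMap K L p ≠ 0 := fun h => hθK (-2 * p) (by
    simp only [map_mul, map_neg, map_ofNat]; linear_combination h)
  -- For `q = 0` the cubic splits and `θ` would be `p` or `-2p`.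
  have hq : algebraMap K L q ≠ 0 := fun h => by
    rw [h] at hθ'
    have : (θ + 2 * algebraMap K L p) ^ 2 * (θ - algebraMap K L p) = 0 := by
      linear_combination hθ'
    exact hθK p (sub_eq_zero.mp ((mul_eq_zero.mp this).resolve_left (pow_ne_zero 2 ht)))
  have : CharZero L := charZero_of_injective_algebraMap (algebraMap K L).injective
  -- Forced by `θ = 3γ² + p` and `γ³ + pγ + q = 0`.
  set γ : L := -3 * algebraMap K L q / (θ + 2 * algebraMap K L p) with hγ
  have hγθ : γ * (θ + 2 * algebraMap K L p) = -3 * algebraMap K L q := by rw [hγ]; field_simp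
  have hγ3 : γ ^ 3 + algebraMap K L p * γ + algebraMap K L q = 0 := by
    refine (mul_eq_zero.mp ?_).resolve_right (pow_ne_zero 3 ht)
    have h3 : γ ^ 3 * (θ + 2 * algebraMap K L p) ^ 3 = -27 * algebraMap K L q ^ 3 := by
      rw [← mul_pow, hγθ]; ring
    linear_combination algebraMap K L q * hθ' + h3 +
      algebraMap K L p * (θ + 2 * algebraMap K L p) ^ 2 * hγθ
  refine ⟨γ, fun k => ?_⟩
  have hγK : γ - algebraMap K L k ∉ (algebraMap K L).range := by
    rintro ⟨m, hm⟩
    have hm' : γ = algebraMap K L (m + k) := by rw [map_add]; linear_combination -hm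
    have hmk : algebraMap K L (m + k) ≠ 0 := fun h => by
      rw [hm', h, zero_mul] at hγθ
      simp [hq] at hγθ
    refine hθK (-3 * q / (m + k) - 2 * p) ?_
    rw [hm'] at hγθ
    simp only [map_sub, map_div₀, map_mul, map_neg, map_ofNat]
    rw [eq_sub_iff_add_eq, eq_div_iff hmk, ← hγθ, mul_comm]
  obtain ⟨e, he⟩ := exists_basis_pow hdeg hγK
  -- Coefficients of `f(X + k)`, which has the same discriminant as `f`.
  rw [Algebra.discr_pow_eq_of_cubic e he (a := -3 * k) (b := -(3 * k ^ 2 + p))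
    (c := -(k ^ 3 + p * k + q)), hD]
  · ring
  · simp only [Algebra.smul_def, map_add, map_mul, map_neg, map_pow, map_ofNat]
    linear_combination hγ3

end CubicExtension

/-! ### From integral bases to `K`-bases -/

section RingOfIntegers

variable {K L : Type*} [Field K] [NumberField K] [Field L] [NumberField L] [Algebra K L]

theorem exists_basis_eq_algebraMap {ι : Type*} [Fintype ι] [DecidableEq ι]
    (b : Module.Basis ι (𝓞 K) (𝓞 L)) :
    ∃ e : Module.Basis ι K L, (∀ i, e i = algebraMap (𝓞 L) L (b i)) ∧
      Algebra.discr K e = algebraMap (𝓞 K) K (Algebra.discr (𝓞 K) b) := by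
  have : IsLocalization (Algebra.algebraMapSubmonoid (𝓞 L) (nonZeroDivisors (𝓞 K))) L :=
    IsIntegralClosure.isLocalization (𝓞 K) K L (𝓞 L)
  exact ⟨b.localizationLocalization K (nonZeroDivisors (𝓞 K)) L, by simp,
    Algebra.discr_localizationLocalization _ _ _ _⟩

theorem algebraMap_discr_ne_zero {ι : Type*} [Fintype ι] [DecidableEq ι]
    (b : Module.Basis ι (𝓞 K) (𝓞 L)) :
    algebraMap (𝓞 K) K (Algebra.discr (𝓞 K) b) ≠ 0 := by
  obtain ⟨e, -, he⟩ := exists_basis_eq_algebraMap b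
  exact he ▸ Algebra.discr_not_zero_of_basis K e

/-- A value of the index form measures the discriminant of an element of `L`. -/
theorem exists_discr_pow_eq_indexForm_sq_mul (b : Module.Basis (Fin 3) (𝓞 K) (𝓞 L))
    (x : Fin 2 → K) :
    ∃ γ : L, Algebra.discr K (fun i : Fin 3 => γ ^ (i : ℕ)) =
      MvPolynomial.aeval x (indexForm b) ^ 2 * algebraMap (𝓞 K) K (Algebra.discr (𝓞 K) b) := by
  obtain ⟨e, he, hdiscr⟩ := exists_basis_eq_algebraMap b
  refine ⟨∑ i, x i • e i.succ, ?_⟩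
  rw [Algebra.discr_eq_det_sq_mul e, hdiscr, aeval_indexForm b e he]

/-- The discriminant of every translation class of elements of `L` is measured by the index
form. -/
theorem exists_indexForm_sq_mul_eq_discr_pow (b : Module.Basis (Fin 3) (𝓞 K) (𝓞 L))
    (hb : b 0 = 1) (γ : L) :
    ∃ (x : Fin 2 → K) (k : K),
      MvPolynomial.aeval x (indexForm b) ^ 2 * algebraMap (𝓞 K) K (Algebra.discr (𝓞 K) b) =
        Algebra.discr K (fun i : Fin 3 => (γ - algebraMap K L k) ^ (i : ℕ)) := by
  obtain ⟨e, he, hdiscr⟩ := exists_basis_eq_algebraMap b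
  refine ⟨fun i => e.repr γ i.succ, e.repr γ 0, ?_⟩
  have hγ : γ - algebraMap K L (e.repr γ 0) = ∑ i : Fin 2, e.repr γ i.succ • e i.succ := by
    have := e.sum_repr γ
    rw [Fin.sum_univ_succ, he 0, hb, map_one, ← Algebra.algebraMap_eq_smul_one] at this
    rw [sub_eq_iff_eq_add', this]
  rw [hγ, Algebra.discr_eq_det_sq_mul e, hdiscr, aeval_indexForm b e he]

/-- The index form takes a value of square `c²` over `K` if and only if `L` is attached to a point
of `E^{-27D}`, where `D` is `c²` times the discriminant of the basis. -/
theorem exists_indexForm_sq_eq_iff (hdeg : Module.finrank K L = 3)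
    (b : Module.Basis (Fin 3) (𝓞 K) (𝓞 L)) (hb : b 0 = 1) {c D : K} (hc : c ≠ 0)
    (hD : D = c ^ 2 * algebraMap (𝓞 K) K (Algebra.discr (𝓞 K) b)) :
    (∃ x : Fin 2 → K, MvPolynomial.aeval x (indexForm b) = c ∨
      MvPolynomial.aeval x (indexForm b) = -c) ↔
      ∃ P ∈ affinePoints (-27 * D), Nonempty (L ≃ₐ[K] pointAlgebra D P) := by
  have hb0 := algebraMap_discr_ne_zero b
  -- The discriminant sees only the square of the index form.
  simp only [← sq_eq_sq_iff_eq_or_eq_neg]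
  constructor
  · rintro ⟨x, hx⟩
    obtain ⟨γ, hγ⟩ := exists_discr_pow_eq_indexForm_sq_mul b x
    rw [hx, ← hD] at hγ
    exact exists_algEquiv_pointAlgebra_of_discr hdeg
      (hD ▸ mul_ne_zero (pow_ne_zero 2 hc) hb0) hγ
  · rintro ⟨P, hP, ⟨e⟩⟩
    obtain ⟨γ, hγ⟩ := exists_discr_pow_eq_of_algEquiv_pointAlgebra hdeg hP e
    obtain ⟨x, k, hx⟩ := exists_indexForm_sq_mul_eq_discr_pow b hb γ
    rw [hγ k, hD] at hx
    exact ⟨x, mul_right_cancel₀ hb0 hx⟩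

end RingOfIntegers

theorem theorem1p1 (K L : Type*) [Field K] [NumberField K] [Field L] [NumberField L]
    [Algebra K L] (hdeg : Module.finrank K L = 3) (hfree : Module.Free (𝓞 K) (𝓞 L)) :
    (IsQuasiMonogenicCubic K L ↔
      ∃ D : K, IsRelativeDiscriminant K L D ∧
        ∃ P ∈ affinePoints (-27 * D), Nonempty (L ≃ₐ[K] pointAlgebra D P)) ∧
    (∀ (b : Module.Basis (Fin 3) (𝓞 K) (𝓞 L)) (D : K), b 0 = 1 →
      D = algebraMap (𝓞 K) K (Algebra.discr (𝓞 K) b) →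
      ((∃ x : Fin 2 → K,
          MvPolynomial.aeval x (indexForm b) = 1 ∨ MvPolynomial.aeval x (indexForm b) = -1) ↔
        ∃ P ∈ affinePoints (-27 * D), Nonempty (L ≃ₐ[K] pointAlgebra D P))) := by
  have hunit (u : (𝓞 K)ˣ) : algebraMap (𝓞 K) K u ≠ 0 := by simp
  refine ⟨⟨?_, ?_⟩, fun b D hb hD =>
    exists_indexForm_sq_eq_iff hdeg b hb one_ne_zero (by rw [hD, one_pow, one_mul])⟩
  · rintro ⟨b, hb, x, u, hx⟩
    -- Scaling one basis vector by `u` multiplies the discriminant by `u²`, absorbing the value of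
    -- the form.
    refine ⟨_, ⟨b.unitsSMul ![u, 1, 1], rfl⟩,
      (exists_indexForm_sq_eq_iff hdeg b hb (hunit u) ?_).mp ⟨x, .inl hx⟩⟩
    rw [Algebra.discr_eq_det_sq_mul b, b.det_unitsSMul_self, map_mul, map_pow]
    simp [Fin.prod_univ_three]
  · rintro ⟨D, ⟨b', hD⟩, hP⟩
    obtain ⟨b, hb⟩ := b'.exists_zero_eq_one
    obtain ⟨u, hu⟩ := b.isUnit_det b'
    rw [Algebra.discr_eq_det_sq_mul b, ← hu, map_mul, map_pow] at hD
    obtain ⟨x, hx | hx⟩ := (exists_indexForm_sq_eq_iff hdeg b hb (hunit u) hD).mpr hP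
    · exact ⟨b, hb, x, u, hx⟩
    · exact ⟨b, hb, x, -u, by simpa using hx⟩
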